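/- Let $\hbar, M, L>0$, $\nu\ge 0$, $\beta\ge 0$, $\varepsilon_0=\hbar^2\pi^2/(2ML^2)$, and for $n\in\mathbb N=\{0,1,2,\dots\}$ put $$E_n=\varepsilon_0\Big((n+\nu+1)^2-\frac{\beta^2}{(n+\nu+1)^2}\Big),\qquad \phi_n(x)=K_n\,\sin^{\nu+n+1}\!\Big(\frac{\pi x}{L}\Big)\exp\!\Big(-\frac{\beta\pi x}{L(\nu+n+1)}\Big)P_n^{(a_n,\bar a_n)}\!\Big(i\cot\frac{\pi x}{L}\Big),$$ the eigenvalues and normalized eigenfunctions of the Pöschl–Teller Hamiltonian $-\frac{\hbar^2}{2M}\frac{d^2}{dx^2}+\varepsilon_0\big(\frac{\nu(\nu+1)}{\sin^2(\pi x/L)}-2\beta\cot\frac{\pi x}{L}\big)$ on $[0,L]$; here $a_n=-(n+\nu+1)+\frac{i\beta}{n+\nu+1}$, $P_n^{(a,b)}$ is the Jacobi polynomial and $K_n>0$ is the constant for which $\phi_n$ has norm $1$ in $L^2([0,L])$. Define recursively, starting from $\phi_n^{(0)}=\phi_n$, for $m\ge 0$, $$W_m=-\hbar\,\frac{(\phi_0^{(m)})'}{\phi_0^{(m)}},\quad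 A_m=\hbar\frac{d}{dx}+W_m,\quad A_m^\dagger=-\hbar\frac{d}{dx}+W_m,\quad B_m=A_m\cdots A_1A_0,\quad B_m^\dagger=A_0^\dagger A_1^\dagger\cdots A_m^\dagger,$$ $$\phi_n^{(m+1)}=\frac{B_m\,\phi_{n+m+1}}{\sqrt{(2M)^{m+1}\prod_{k=0}^m (E_{n+m+1}-E_k)}} .$$ For integers $m\ge 0$ and $n\ge -m-1$ let $\mathcal M(n,m)\ge 0$ be given by $$\mathcal M(n,m)^2=\prod_{k=0}^m (n+m-k+1)(n+m+2\nu+k+3)\Big(1+\frac{\beta^2}{[(k+\nu+1)(n+m+\nu+2)]^2}\Big),$$ and write $\langle T\rangle_f=\int_0^L\overline{f(x)}\,(Tf)(x)\,dx$. Then for all $m,n\in\mathbb N$ the functions $\phi_0^{(k)}$, $0\le k\le m$, have no zero in $(0,L)$ and the functions $\phi_j^{(k)}$, $0\le k\le m+1$, $j\ge 0$, are smooth on $(0,L)$ (so that the operators above act on them classically); the functions $\phi_n^{(m+1)}$, $B_mB_m^\dagger\phi_n^{(m+1)}$, $\phi_n$ and $B_m^\dagger B_m\phi_n$ lie in $L^2([0,L])$;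 and $$\langle B_mB_m^\dagger\rangle_{\phi_n^{(m+1)}}=\Big[\Big(\frac{\pi\hbar}{L}\Big)^{m+1}\mathcal M(n,m)\Big]^2,\qquad \langle B_m^\dagger B_m\rangle_{\phi_n}=\Big[\Big(\frac{\pi\hbar}{L}\Big)^{m+1}\mathcal M(n-m-1,m)\Big]^2 .$$ -/

import Mathlib

open MeasureTheory
open scoped ContDiff

/-- The physical and shape parameters of the Pöschl-Teller model on `[0, L]`. -/
structure PTParams where
  /-- the reduced Planck constant `ħ` -/
  hbar : ℝ
  /-- the particle mass `M` -/
  mass : ℝ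
  /-- the width `L` of the interval -/
  L : ℝ
  /-- the parameter `ν` -/
  nu : ℝ
  /-- the parameter `β` -/
  beta : ℝ

/-- The Jacobi polynomial `P_n^{(a,b)}(z)` with arbitrary complex parameters:
`(1/n!) ∑_k C(n,k) (n+a+b+1)_k (a+k+1)_{n-k} ((z-1)/2)^k`, where `(c)_k` is the rising factorial. -/
noncomputable def jacobiP (n : ℕ) (a b z : ℂ) : ℂ :=
  (∑ k ∈ Finset.range (n + 1),
    (n.choose k : ℂ) * (ascPochhammer ℂ k).eval ((n : ℂ) + a + b + 1) *
      (ascPochhammer ℂ (n - k)).eval (a + (k : ℂ) + 1) * ((z - 1) / 2) ^ k) / (n.factorial : ℂ)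

namespace PTParams

/-- The energy scale `ε₀ = ħ²π² / (2ML²)`. -/
noncomputable def eps0 (p : PTParams) : ℝ :=
  p.hbar ^ 2 * Real.pi ^ 2 / (2 * p.mass * p.L ^ 2)

/-- The eigenvalue `E_n = ε₀ ((n+ν+1)² - β²/(n+ν+1)²)`. -/
noncomputable def energy (p : PTParams) (n : ℕ) : ℝ :=
  p.eps0 * (((n : ℝ) + p.nu + 1) ^ 2 - p.beta ^ 2 / ((n : ℝ) + p.nu + 1) ^ 2)

/-- The Jacobi parameter `a_n = -(n+ν+1) + iβ/(n+ν+1)`. -/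
noncomputable def jacobiParam (p : PTParams) (n : ℕ) : ℂ :=
  ⟨-((n : ℝ) + p.nu + 1), p.beta / ((n : ℝ) + p.nu + 1)⟩

/-- The eigenfunction before normalization:
`sin^{ν+n+1}(πx/L) exp(-βπx/(L(ν+n+1))) P_n^{(a_n, ā_n)}(i cot(πx/L))`. -/
noncomputable def rawEigenfunction (p : PTParams) (n : ℕ) (x : ℝ) : ℂ :=
  ((Real.sin (Real.pi * x / p.L) ^ (p.nu + (n : ℝ) + 1) *
      Real.exp (-(p.beta * Real.pi * x / (p.L * (p.nu + (n : ℝ) + 1)))) : ℝ) : ℂ) *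
    jacobiP n (p.jacobiParam n) (star (p.jacobiParam n))
      (Complex.I * ((Real.cot (Real.pi * x / p.L) : ℝ) : ℂ))

/-- The normalization constant `K_n > 0`, the inverse of the norm in `L²([0, L])`. -/
noncomputable def normConst (p : PTParams) (n : ℕ) : ℝ :=
  (Real.sqrt (∫ x in (0 : ℝ)..p.L, ‖p.rawEigenfunction n x‖ ^ 2))⁻¹

/-- The normalized eigenfunction `φ_n` of the Pöschl-Teller Hamiltonian. -/
noncomputable def phi (p : PTParams) (n : ℕ) (x : ℝ) : ℂ :=
  (p.normConst n : ℂ) * p.rawEigenfunction n x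

/-- The first order differential operator `ħ d/dx + W`. -/
noncomputable def lowerWith (p : PTParams) (W f : ℝ → ℂ) (x : ℝ) : ℂ :=
  (p.hbar : ℂ) * deriv f x + W x * f x

/-- The first order differential operator `-ħ d/dx + W`. -/
noncomputable def raiseWith (p : PTParams) (W f : ℝ → ℂ) (x : ℝ) : ℂ :=
  -(p.hbar : ℂ) * deriv f x + W x * f x

/-- The superpotential `-ħ g'/g` of a ground state `g`. -/
noncomputable def superpotentialOf (p : PTParams) (g : ℝ → ℂ) (x : ℝ) : ℂ :=
  -(p.hbar : ℂ) * deriv g x / g x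

/-- Given `T = A_{m-1} ⋯ A_1 A_0`, the function
`φ_n^{(m)} = T φ_{n+m} / √((2M)^m ∏_{k<m} (E_{n+m} - E_k))`. -/
noncomputable def hierState (p : PTParams) (T : (ℝ → ℂ) → ℝ → ℂ) (m n : ℕ) (x : ℝ) : ℂ :=
  T (p.phi (n + m)) x /
    ((Real.sqrt ((2 * p.mass) ^ m *
      ∏ k ∈ Finset.range m, (p.energy (n + m) - p.energy k)) : ℝ) : ℂ)

/-- The product `A_{m-1} ⋯ A_1 A_0` (the identity for `m = 0`), where
`A_k = ħ d/dx + W_k` and `W_k = -ħ (φ_0^{(k)})' / φ_0^{(k)}`. -/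
noncomputable def lowerProd (p : PTParams) : ℕ → (ℝ → ℂ) → ℝ → ℂ
  | 0 => fun f => f
  | m + 1 => fun f =>
      p.lowerWith (p.superpotentialOf (p.hierState (p.lowerProd m) m 0)) (p.lowerProd m f)

/-- The eigenfunction `φ_n^{(m)}` of the `m`-th Hamiltonian of the hierarchy; `φ_n^{(0)} = φ_n`. -/
noncomputable def eigenfunction (p : PTParams) (m n : ℕ) : ℝ → ℂ :=
  p.hierState (p.lowerProd m) m n

/-- The superpotential `W_m = -ħ (φ_0^{(m)})' / φ_0^{(m)}`. -/
noncomputable def superpotential (p : PTParams) (m : ℕ) : ℝ → ℂ :=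
  p.superpotentialOf (p.eigenfunction m 0)

/-- The operator `A_m = ħ d/dx + W_m`; `A_0` is the operator without index. -/
noncomputable def opA (p : PTParams) (m : ℕ) (f : ℝ → ℂ) : ℝ → ℂ :=
  p.lowerWith (p.superpotential m) f

/-- The operator `A_m† = -ħ d/dx + W_m`. -/
noncomputable def opAdag (p : PTParams) (m : ℕ) (f : ℝ → ℂ) : ℝ → ℂ :=
  p.raiseWith (p.superpotential m) f

/-- The operator `B_m = A_m ⋯ A_1 A_0`. -/
noncomputable def opB (p : PTParams) : ℕ → (ℝ → ℂ) → ℝ → ℂ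
  | 0 => fun f => p.opA 0 f
  | m + 1 => fun f => p.opA (m + 1) (p.opB m f)

/-- The operator `B_m† = A_0† A_1† ⋯ A_m†`. -/
noncomputable def opBdag (p : PTParams) : ℕ → (ℝ → ℂ) → ℝ → ℂ
  | 0 => fun f => p.opAdag 0 f
  | m + 1 => fun f => p.opBdag m (p.opAdag (m + 1) f)

/-- The quantity `𝓜(n,m)`, the nonnegative square root of
`∏_{k=0}^m (n+m-k+1)(n+m+2ν+k+3)(1 + β²/[(k+ν+1)(n+m+ν+2)]²)`; here `n` is an integer `≥ -m-1`. -/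
noncomputable def calM (p : PTParams) (n : ℤ) (m : ℕ) : ℝ :=
  Real.sqrt (∏ k ∈ Finset.range (m + 1),
    (((n : ℝ) + m - k + 1) * ((n : ℝ) + m + 2 * p.nu + k + 3) *
      (1 + p.beta ^ 2 / (((k : ℝ) + p.nu + 1) * ((n : ℝ) + m + p.nu + 2)) ^ 2)))

/-- The mean value `⟨T⟩_f = ∫_0^L conj(f) T f dx`. -/
noncomputable def meanValue (p : PTParams) (T : (ℝ → ℂ) → ℝ → ℂ) (f : ℝ → ℂ) : ℂ :=
  ∫ x in (0 : ℝ)..p.L, star (f x) * T f x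

/-- Membership in the Hilbert space `L²([0, L])`. -/
def InL2 (p : PTParams) (f : ℝ → ℂ) : Prop :=
  MemLp f 2 (volume.restrict (Set.Icc 0 p.L))

/-- `A_m ⋯ A_0` built in the recursion is the product of the operators `A_k`. -/
theorem lowerProd_succ (p : PTParams) (m : ℕ) (f : ℝ → ℂ) :
    p.lowerProd (m + 1) f = p.opA m (p.lowerProd m f) := rfl

/-- Hence `φ_n^{(m+1)}` is `B_m φ_{n+m+1}` divided by the stated square root. -/
theorem lowerProd_succ_eq_opB (p : PTParams) (m : ℕ) (f : ℝ → ℂ) :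
    p.lowerProd (m + 1) f = p.opB m f := by
  induction m with
  | zero => rfl
  | succ m ih => rw [lowerProd_succ, ih]; rfl

/-- The zeroth level of the hierarchy is the original one. -/
theorem eigenfunction_zero (p : PTParams) (n : ℕ) : p.eigenfunction 0 n = p.phi n := by
  funext x
  simp [eigenfunction, hierState, lowerProd]

end PTParams

/-! With `θ = πx/L`, `t = cot θ` and `s = N + ν + 1`, every function that arises from `φ_N` has the
form `sin^s θ · exp(-βθ/s) · q(t)` for a polynomial `q`; this is `wave p N q`. Differentiation
preserves this form. Once `W_k` is known to be `(πħ/L)(β/(k+ν+1) - (k+ν+1) t)`, the operators `A_k`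
and `A_k†` become the maps `lowerPoly` and `raisePoly` on polynomials.

Shape invariance (`lowerPoly_raisePoly`) says that `A_k A_k†` and `A_{k+1}† A_{k+1}` differ by a
constant. The Jacobi equation makes `φ_N` an eigenfunction of `A_0† A_0`, so by induction `A_k† A_k`
acts on `A_{k-1}⋯A_0 φ_N` as `gap N k = 2M(E_N - E_k)` (`IsBase.raise_lower`). Hence `B_m† B_m φ_N =
(∏_{k≤m} gap N k) φ_N`, and `B_m B_m†` has the same eigenvalue on `B_m φ_N`. This product is
`[(πħ/L)^{m+1} 𝓜]²`.

Two points remain. The form of `W_k` requires `φ_0^{(k)}` to have a constant polynomial factor; this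
follows from a degree drop at each lowering (`IsBase.natDegree_chain_le`). The states must have norm
1; this follows because `A_k` and `A_k†` are adjoint on the waves involved (`integral_lower_raise`).
-/

/-! ### Jacobi polynomials with complex parameters -/

open Polynomial in
/-- The Jacobi polynomial in the variable `(z - 1) / 2`. -/
noncomputable def jacobiPoly (n : ℕ) (a b : ℂ) : ℂ[X] :=
  ∑ k ∈ Finset.range (n + 1), Polynomial.monomial k
    ((n.choose k : ℂ) * (ascPochhammer ℂ k).eval ((n : ℂ) + a + b + 1) *
      (ascPochhammer ℂ (n - k)).eval (a + (k : ℂ) + 1) / (n.factorial : ℂ))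

theorem jacobiP_eq_eval (n : ℕ) (a b z : ℂ) :
    jacobiP n a b z = (jacobiPoly n a b).eval ((z - 1) / 2) := by
  simp only [jacobiP, jacobiPoly, Polynomial.eval_finsetSum, Polynomial.eval_monomial,
    Finset.sum_div]
  refine Finset.sum_congr rfl fun k _ => ?_
  ring

theorem coeff_jacobiPoly (n : ℕ) (a b : ℂ) (k : ℕ) :
    (jacobiPoly n a b).coeff k =
      (n.choose k : ℂ) * (ascPochhammer ℂ k).eval ((n : ℂ) + a + b + 1) *
      (ascPochhammer ℂ (n - k)).eval (a + (k : ℂ) + 1) / (n.factorial : ℂ) := by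
  simp only [jacobiPoly, Polynomial.finsetSum_coeff, Polynomial.coeff_monomial]
  rw [Finset.sum_ite_eq']
  split_ifs with h
  · rfl
  · rw [Nat.choose_eq_zero_of_lt (by simpa using h)]
    simp

theorem natDegree_jacobiPoly_le (n : ℕ) (a b : ℂ) : (jacobiPoly n a b).natDegree ≤ n := by
  rw [Polynomial.natDegree_le_iff_coeff_eq_zero]
  intro k hk
  rw [coeff_jacobiPoly, Nat.choose_eq_zero_of_lt hk]
  simp

/-- The hypergeometric recurrence, cleared of denominators because `a + k + 1` may vanish. Read
coefficientwise, it is the Jacobi equation. -/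
theorem coeff_jacobiPoly_succ (n : ℕ) (a b : ℂ) (k : ℕ) :
    ((k : ℂ) + 1) * (a + k + 1) * (jacobiPoly n a b).coeff (k + 1) =
      ((n : ℂ) - k) * (n + a + b + 1 + k) * (jacobiPoly n a b).coeff k := by
  rw [coeff_jacobiPoly, coeff_jacobiPoly]
  rcases lt_trichotomy k n with h | rfl | h
  · obtain ⟨d, rfl⟩ : ∃ d, n = k + 1 + d := ⟨n - (k + 1), by omega⟩
    have h1 : k + 1 + d - k = d + 1 := by omega
    have h2 : k + 1 + d - (k + 1) = d := by omega
    rw [h1, h2, ascPochhammer_succ_eval, ascPochhammer_succ_left, Polynomial.eval_mul,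
      Polynomial.eval_comp]
    have h3 : (((k + 1 + d).choose (k + 1) : ℕ) : ℂ) * (k + 1) =
        ((k + 1 + d).choose k : ℕ) * ((d : ℂ) + 1) := by
      have := Nat.choose_succ_right_eq (k + 1 + d) k
      rw [h1] at this
      exact_mod_cast this
    simp only [Polynomial.eval_X, Polynomial.eval_add, Polynomial.eval_one]
    have h4 : a + ((k + 1 : ℕ) : ℂ) + 1 = a + k + 1 + 1 := by push_cast; ring
    rw [h4]
    push_cast
    linear_combination (a + k + 1) * (Polynomial.eval (k + 1 + d + a + b + 1) (ascPochhammer ℂ k)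
      * (k + 1 + d + a + b + 1 + k)) *
      Polynomial.eval (a + k + 1 + 1) (ascPochhammer ℂ d) / ((k + 1 + d).factorial : ℂ) * h3
  · rw [Nat.choose_succ_self]
    simp
  · rw [Nat.choose_eq_zero_of_lt h, Nat.choose_eq_zero_of_lt (by omega)]
    simp

open Polynomial in
/-- The Jacobi differential equation. -/
theorem jacobiPoly_ode (n : ℕ) (a b : ℂ) :
    X * (1 + X) * derivative (derivative (jacobiPoly n a b)) +
      (C (a + 1) + C (a + b + 2) * X) * derivative (jacobiPoly n a b) =
      C (n * (n + a + b + 1)) * jacobiPoly n a b := by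
  set J := jacobiPoly n a b with hJ
  have e : X * (1 + X) * derivative (derivative J) +
      (C (a + 1) + C (a + b + 2) * X) * derivative J =
      X * derivative (derivative J) + X * (X * derivative (derivative J)) +
      C (a + 1) * derivative J + C (a + b + 2) * (X * derivative J) := by ring
  obtain ⟨A, hA⟩ : ∃ A, A = a + 1 := ⟨_, rfl⟩
  obtain ⟨B, hB⟩ : ∃ B, B = a + b + 2 := ⟨_, rfl⟩
  obtain ⟨E, hE⟩ : ∃ E, E = n * (n + a + b + 1) := ⟨_, rfl⟩
  rw [e, ← hA, ← hB, ← hE]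
  ext k
  have h := coeff_jacobiPoly_succ n a b k
  rw [← hJ] at h
  rcases k with _ | _ | k
  · simp [coeff_derivative] at h ⊢
    rw [hA, hE]
    linear_combination h
  · simp [coeff_X_mul, coeff_derivative] at h ⊢
    rw [hA, hB, hE]
    linear_combination h
  · simp [coeff_X_mul, coeff_derivative] at h ⊢
    rw [hA, hB, hE]
    linear_combination h

/-! ### The ladder operators on polynomials in `cot θ`, and shape invariance -/

namespace PTParams
open Polynomial

/-- The shape parameter `k + ν + 1` of the `k`-th Hamiltonian of the hierarchy. -/
noncomputable def level (p : PTParams) (k : ℕ) : ℝ := k + p.nu + 1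

/-- The momentum scale `πħ / L`. -/
noncomputable def scale (p : PTParams) : ℝ := Real.pi * p.hbar / p.L

theorem level_pos {p : PTParams} (hnu : 0 ≤ p.nu) (k : ℕ) : 0 < p.level k := by
  unfold level; positivity

theorem level_ne {p : PTParams} (hnu : 0 ≤ p.nu) (k : ℕ) : (p.level k : ℂ) ≠ 0 :=
  Complex.ofReal_ne_zero.mpr (level_pos hnu k).ne'

theorem scale_pos {p : PTParams} (hhbar : 0 < p.hbar) (hL : 0 < p.L) : 0 < p.scale := by
  unfold scale; positivity

/-- The functions `sin^{s} exp(-βθ/s) q(cot θ)`, with `θ = πx/L` and `s = N + ν + 1`. -/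
noncomputable def wave (p : PTParams) (N : ℕ) (q : ℂ[X]) (x : ℝ) : ℂ :=
  ((Real.sin (Real.pi * x / p.L) ^ p.level N *
      Real.exp (-(p.beta * Real.pi * x / (p.L * p.level N))) : ℝ) : ℂ) *
    q.eval ((Real.cot (Real.pi * x / p.L) : ℝ) : ℂ)

/-- The superpotential of the `k`-th level as a polynomial in `cot θ`. -/
noncomputable def superPoly (p : PTParams) (k : ℕ) : ℂ[X] :=
  C (p.scale : ℂ) * (C ((p.beta : ℂ) / p.level k) - C (p.level k : ℂ) * X)

/-- The action of `ħ d/dx` on `wave p N q`. -/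
noncomputable def diffPoly (p : PTParams) (N : ℕ) (q : ℂ[X]) : ℂ[X] :=
  C (p.scale : ℂ) * ((C (p.level N : ℂ) * X - C ((p.beta : ℂ) / p.level N)) * q -
    (1 + X ^ 2) * derivative q)

/-- The action of `A_k` on `wave p N q`. -/
noncomputable def lowerPoly (p : PTParams) (N k : ℕ) (q : ℂ[X]) : ℂ[X] :=
  p.diffPoly N q + p.superPoly k * q

/-- The action of `A_k†` on `wave p N q`. -/
noncomputable def raisePoly (p : PTParams) (N k : ℕ) (q : ℂ[X]) : ℂ[X] :=
  -p.diffPoly N q + p.superPoly k * q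

/-- The eigenvalue of `A_k† A_k` at level `N`. -/
noncomputable def gap (p : PTParams) (N k : ℕ) : ℝ :=
  p.scale ^ 2 * (p.level N ^ 2 - p.level k ^ 2) * (1 + p.beta ^ 2 / (p.level k * p.level N) ^ 2)

theorem gap_eq_energy {p : PTParams} (hmass : 0 < p.mass) (hL : 0 < p.L) (hnu : 0 ≤ p.nu)
    (N k : ℕ) : 2 * p.mass * (p.energy N - p.energy k) = p.gap N k := by
  have h1 := (level_pos hnu N).ne'
  have h2 := (level_pos hnu k).ne'
  simp only [energy, gap, eps0, scale]
  change 2 * p.mass * (_ * (p.level N ^ 2 - p.beta ^ 2 / p.level N ^ 2) -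
    _ * (p.level k ^ 2 - p.beta ^ 2 / p.level k ^ 2)) = _
  field_simp
  ring

theorem gap_pos {p : PTParams} (hhbar : 0 < p.hbar) (hL : 0 < p.L) (hnu : 0 ≤ p.nu)
    {N k : ℕ} (h : k < N) : 0 < p.gap N k := by
  have h1 := level_pos hnu N
  have h2 := level_pos hnu k
  have h3 := scale_pos hhbar hL
  have h4 : p.level k < p.level N := by
    simp only [level]
    have : (k : ℝ) < N := by exact_mod_cast h
    linarith
  have h5 : 0 < p.level N ^ 2 - p.level k ^ 2 := by nlinarith
  unfold gap
  positivity

theorem gap_self (p : PTParams) (N : ℕ) : p.gap N N = 0 := by simp [gap]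

/-- Shape invariance: with `l = level k`, both `W_k² + ħW_k'` and `W_{k+1}² - ħW_{k+1}'` have `cot²`
coefficient `scale² · l(l+1)` and `cot` coefficient `-2β · scale²`, so only a constant separates
them. -/
theorem lowerPoly_raisePoly {p : PTParams} (hnu : 0 ≤ p.nu) (N k : ℕ) (q : ℂ[X]) :
    p.lowerPoly N k (p.raisePoly N k q) =
      p.raisePoly N (k + 1) (p.lowerPoly N (k + 1) q) +
        C ((p.gap N k - p.gap N (k + 1) : ℝ) : ℂ) * q := by
  have h1 := level_ne hnu N
  have h2 := level_ne hnu k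
  have h3 := level_ne hnu (k + 1)
  have h4 : (p.level (k + 1) : ℂ) = p.level k + 1 := by simp [level]; ring
  apply Polynomial.funext
  intro t
  simp only [lowerPoly, raisePoly, diffPoly, superPoly, gap, derivative_add, derivative_sub,
    derivative_mul, derivative_neg, derivative_C, derivative_X, derivative_X_pow, derivative_one,
    eval_add, eval_sub, eval_mul, eval_neg, eval_C, eval_X, eval_pow, eval_one, eval_zero]
  push_cast
  rw [h4] at h3 ⊢
  field_simp
  ring

theorem raisePoly_C_mul (p : PTParams) (N k : ℕ) (c : ℂ) (q : ℂ[X]) :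
    p.raisePoly N k (C c * q) = C c * p.raisePoly N k q := by
  simp only [raisePoly, diffPoly, derivative_mul, derivative_C]; ring

theorem lowerPoly_C_mul (p : PTParams) (N k : ℕ) (c : ℂ) (q : ℂ[X]) :
    p.lowerPoly N k (C c * q) = C c * p.lowerPoly N k q := by
  simp only [lowerPoly, diffPoly, derivative_mul, derivative_C]; ring

/-! ### Chains of lowerings: eigenvalues and degrees -/

/-- The polynomial of `A_{k-1} ⋯ A_0` applied to `wave p N q`. -/
noncomputable def chainPoly (p : PTParams) (N : ℕ) (q : ℂ[X]) : ℕ → ℂ[X]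
  | 0 => q
  | k + 1 => p.lowerPoly N k (chainPoly p N q k)

/-- The polynomial of `A_0† ⋯ A_{k-1}†` applied to `wave p N q`. -/
noncomputable def raiseChain (p : PTParams) (N : ℕ) : ℕ → ℂ[X] → ℂ[X]
  | 0 => fun q => q
  | k + 1 => fun q => raiseChain p N k (p.raisePoly N k q)

/-- `q` is the polynomial of an eigenfunction of `A_0† A_0` at level `N`. -/
structure IsBase (p : PTParams) (N : ℕ) (q : ℂ[X]) : Prop where
  natDegree_le : q.natDegree ≤ N
  eigen : p.raisePoly N 0 (p.lowerPoly N 0 q) = C (p.gap N 0 : ℂ) * q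

theorem IsBase.C_mul {p : PTParams} {N : ℕ} {q : ℂ[X]} (h : p.IsBase N q) (c : ℂ) :
    p.IsBase N (C c * q) where
  natDegree_le := (natDegree_C_mul_le c q).trans h.natDegree_le
  eigen := by rw [lowerPoly_C_mul, raisePoly_C_mul, h.eigen]; ring

/-- Applying `A_k` to the eigenrelation at `k` gives one for `A_k A_k†` on the next chain element;
shape invariance then trades this for `A_{k+1}† A_{k+1}`, and the constants telescope to `gap N
(k+1)`. -/
theorem IsBase.raise_lower {p : PTParams} {N : ℕ} {q : ℂ[X]} (h : p.IsBase N q)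
    (hnu : 0 ≤ p.nu) (k : ℕ) :
    p.raisePoly N k (p.lowerPoly N k (p.chainPoly N q k)) =
      C (p.gap N k : ℂ) * p.chainPoly N q k := by
  induction k with
  | zero => exact h.eigen
  | succ k ih =>
    have h1 := lowerPoly_raisePoly hnu N k (p.chainPoly N q (k + 1))
    change p.lowerPoly N k (p.raisePoly N k (p.lowerPoly N k (p.chainPoly N q k))) = _ at h1
    rw [ih, lowerPoly_C_mul] at h1
    change C _ * p.chainPoly N q (k + 1) = _ at h1
    rw [Complex.ofReal_sub, C_sub] at h1
    linear_combination -h1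

theorem coeff_diffPoly_succ (p : PTParams) (N d : ℕ) (q : ℂ[X]) (hq : q.natDegree ≤ d) :
    (p.diffPoly N q).coeff (d + 1) = p.scale * ((p.level N - d) * q.coeff d) := by
  have e : p.diffPoly N q = C (p.scale : ℂ) * (C (p.level N : ℂ) * (X * q) -
      C ((p.beta : ℂ) / p.level N) * q - derivative q - X * (X * derivative q)) := by
    unfold diffPoly; ring
  have h1 : q.coeff (d + 1) = 0 := coeff_eq_zero_of_natDegree_lt (by omega)
  have h2 : q.coeff (d + 1 + 1) = 0 := coeff_eq_zero_of_natDegree_lt (by omega)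
  rw [e]
  rcases d with _ | d
  · simp [coeff_X_mul, coeff_derivative, h1, h2]
  · simp [coeff_X_mul, coeff_derivative, h1, h2]
    exact Or.inl (by ring)

theorem coeff_superPoly_mul_succ (p : PTParams) (k d : ℕ) (q : ℂ[X]) (hq : q.natDegree ≤ d) :
    (p.superPoly k * q).coeff (d + 1) = -p.scale * (p.level k * q.coeff d) := by
  have e : p.superPoly k * q = C (p.scale : ℂ) * (C ((p.beta : ℂ) / p.level k) * q -
      C (p.level k : ℂ) * (X * q)) := by
    unfold superPoly; ring
  have h1 : q.coeff (d + 1) = 0 := coeff_eq_zero_of_natDegree_lt (by omega)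
  rw [e]
  simp [coeff_X_mul, h1]

theorem natDegree_diffPoly_le (p : PTParams) (N d : ℕ) (q : ℂ[X]) (hq : q.natDegree ≤ d) :
    (p.diffPoly N q).natDegree ≤ d + 1 := by
  have hd : (derivative q).natDegree ≤ d - 1 := (natDegree_derivative_le q).trans (by omega)
  rcases d with _ | d
  · have : derivative q = 0 := by
      rw [eq_C_of_natDegree_le_zero hq]; simp
    unfold diffPoly
    rw [this, mul_zero, sub_zero]
    have h1 : (C (p.level N : ℂ) * X - C ((p.beta : ℂ) / p.level N)).natDegree ≤ 1 := by
      compute_degree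
    exact (natDegree_C_mul_le _ _).trans ((natDegree_mul_le_of_le h1 hq).trans (by omega))
  · rw [Nat.add_sub_cancel] at hd
    have h2 : ((1 + X ^ 2 : ℂ[X]) * derivative q).natDegree ≤ 2 + d :=
      natDegree_mul_le_of_le (by compute_degree) hd
    unfold diffPoly
    refine (natDegree_C_mul_le _ _).trans ((natDegree_sub_le _ _).trans
      (max_le ?_ (h2.trans (by omega))))
    have h1 : (C (p.level N : ℂ) * X - C ((p.beta : ℂ) / p.level N)).natDegree ≤ 1 := by
      compute_degree
    exact (natDegree_mul_le_of_le h1 hq).trans (by omega)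

theorem natDegree_superPoly_mul_le (p : PTParams) (k d : ℕ) (q : ℂ[X]) (hq : q.natDegree ≤ d) :
    (p.superPoly k * q).natDegree ≤ d + 1 :=
  (natDegree_mul_le_of_le (m := 1) (by unfold superPoly; compute_degree) hq).trans (by omega)

/-- A lowering could raise the degree by one, so two top coefficients must vanish for the degree to
drop. The first vanishes because `level N - level k = N - k`, the second because of the
eigenrelation. -/
theorem IsBase.natDegree_chain_le {p : PTParams} {N : ℕ} {q : ℂ[X]} (h : p.IsBase N q)
    (hhbar : 0 < p.hbar) (hL : 0 < p.L) (hnu : 0 ≤ p.nu) {k : ℕ} (hk : k ≤ N) :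
    (p.chainPoly N q k).natDegree ≤ N - k := by
  induction k with
  | zero => exact h.natDegree_le
  | succ k ih =>
    specialize ih (by omega)
    obtain ⟨d, rfl⟩ : ∃ d, N = k + 1 + d := ⟨N - (k + 1), by omega⟩
    rw [show k + 1 + d - k = d + 1 by omega] at ih
    rw [show k + 1 + d - (k + 1) = d by omega]
    have hs : (p.scale : ℂ) ≠ 0 := Complex.ofReal_ne_zero.mpr (scale_pos hhbar hL).ne'
    have hlev : (p.level (k + 1 + d) : ℂ) = p.level k + d + 1 := by
      simp [level]; ring
    set f := p.chainPoly (k + 1 + d) q k with hf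
    change (p.lowerPoly (k + 1 + d) k f).natDegree ≤ d
    set r := p.lowerPoly (k + 1 + d) k f with hr
    have hr2 : r.natDegree ≤ d + 1 + 1 := natDegree_add_le_of_degree_le
      (natDegree_diffPoly_le _ _ _ _ ih) (natDegree_superPoly_mul_le _ _ _ _ ih)
    have hr2' : r.coeff (d + 1 + 1) = 0 := by
      rw [hr, lowerPoly, coeff_add, coeff_diffPoly_succ _ _ _ _ ih,
        coeff_superPoly_mul_succ _ _ _ _ ih, hlev]
      push_cast
      ring
    have hr1 : r.natDegree ≤ d + 1 := by
      rw [natDegree_le_iff_coeff_eq_zero]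
      intro j hj
      rcases (show d + 1 + 1 ≤ j from hj).eq_or_lt with rfl | hj
      · exact hr2'
      · exact coeff_eq_zero_of_natDegree_lt (by omega)
    -- The right side has degree at most `d + 1`. In the coefficient of degree `d + 2` on the left,
    -- the two parts of `raisePoly` add up to `-2 · scale · level k` times `r.coeff (d + 1)`.
    have heig := congrArg (fun g => coeff g (d + 1 + 1)) (h.raise_lower hnu k)
    simp only [← hf, ← hr] at heig
    rw [coeff_C_mul, coeff_eq_zero_of_natDegree_lt (p := f) (by omega), raisePoly, coeff_add,
      coeff_neg, coeff_diffPoly_succ _ _ _ _ hr1, coeff_superPoly_mul_succ _ _ _ _ hr1,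
      hlev] at heig
    have hr1' : r.coeff (d + 1) = 0 := by
      have : ((2 * p.level k : ℝ) : ℂ) ≠ 0 :=
        Complex.ofReal_ne_zero.mpr (by have := level_pos hnu k; positivity)
      push_cast at this heig
      have h0 : (p.scale : ℂ) * (2 * p.level k) * r.coeff (d + 1) = 0 := by
        linear_combination -heig
      simpa [hs, this] using h0
    rw [natDegree_le_iff_coeff_eq_zero]
    intro j hj
    rcases (show d + 1 ≤ j from hj).eq_or_lt with rfl | hj
    · exact hr1'
    · exact coeff_eq_zero_of_natDegree_lt (by omega)

/-- Raising back multiplies by `gap N k`, which is nonzero for `k < N`, so no lowering up to `N`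
annihilates the chain. -/
theorem IsBase.chain_ne_zero {p : PTParams} {N : ℕ} {q : ℂ[X]} (h : p.IsBase N q)
    (hhbar : 0 < p.hbar) (hL : 0 < p.L) (hnu : 0 ≤ p.nu) (hq : q ≠ 0) {k : ℕ} (hk : k ≤ N) :
    p.chainPoly N q k ≠ 0 := by
  induction k with
  | zero => exact hq
  | succ k ih =>
    intro h0
    have h1 := h.raise_lower hnu k
    change p.raisePoly N k (p.chainPoly N q (k + 1)) = _ at h1
    rw [h0] at h1
    have h2 : C (p.gap N k : ℂ) * p.chainPoly N q k = 0 := by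
      rw [← h1]; simp [raisePoly, diffPoly]
    have h3 : (p.gap N k : ℂ) ≠ 0 :=
      Complex.ofReal_ne_zero.mpr (gap_pos hhbar hL hnu (by omega)).ne'
    simp only [mul_eq_zero, C_eq_zero, h3, false_or] at h2
    exact ih (by omega) h2

/-- This is the ground state of level `N`: after `N` lowerings only the nonvanishing factor `sin^s θ
· exp(-βθ/s)` is left. -/
theorem IsBase.chain_self {p : PTParams} {N : ℕ} {q : ℂ[X]} (h : p.IsBase N q)
    (hhbar : 0 < p.hbar) (hL : 0 < p.L) (hnu : 0 ≤ p.nu) (hq : q ≠ 0) :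
    ∃ c : ℂ, c ≠ 0 ∧ p.chainPoly N q N = C c := by
  have h1 := h.natDegree_chain_le hhbar hL hnu le_rfl
  rw [Nat.sub_self] at h1
  refine ⟨_, ?_, eq_C_of_natDegree_le_zero h1⟩
  intro h0
  apply h.chain_ne_zero hhbar hL hnu hq le_rfl
  rw [eq_C_of_natDegree_le_zero h1, h0, C_0]

theorem lowerPoly_self_C (p : PTParams) (N : ℕ) (c : ℂ) : p.lowerPoly N N (C c) = 0 := by
  simp only [lowerPoly, diffPoly, superPoly, derivative_C]; ring

/-- Beyond `k = N` the chain is zero, since `A_N` kills the ground state. This covers `B_m φ_n` with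
`n ≤ m`. -/
theorem IsBase.natDegree_chain_le_sub {p : PTParams} {N : ℕ} {q : ℂ[X]} (h : p.IsBase N q)
    (hhbar : 0 < p.hbar) (hL : 0 < p.L) (hnu : 0 ≤ p.nu) (k : ℕ) :
    (p.chainPoly N q k).natDegree ≤ N - k := by
  rcases le_or_gt k N with hk | hk
  · exact h.natDegree_chain_le hhbar hL hnu hk
  · have : p.chainPoly N q k = 0 := by
      induction k, hk using Nat.le_induction with
      | base =>
        have h1 := h.natDegree_chain_le hhbar hL hnu le_rfl
        rw [Nat.sub_self] at h1
        change p.lowerPoly N N (p.chainPoly N q N) = 0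
        rw [eq_C_of_natDegree_le_zero h1, lowerPoly_self_C]
      | succ k _ ih =>
        change p.lowerPoly N k (p.chainPoly N q k) = 0
        rw [ih]; simp [lowerPoly, diffPoly]
    simp [this]

theorem raiseChain_C_mul (p : PTParams) (N k : ℕ) (c : ℂ) (q : ℂ[X]) :
    p.raiseChain N k (C c * q) = C c * p.raiseChain N k q := by
  induction k generalizing q with
  | zero => rfl
  | succ k ih => simp only [raiseChain, raisePoly_C_mul, ih]

theorem IsBase.raiseChain_chain {p : PTParams} {N : ℕ} {q : ℂ[X]} (h : p.IsBase N q)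
    (hnu : 0 ≤ p.nu) (k : ℕ) :
    p.raiseChain N k (p.chainPoly N q k) = C ((∏ j ∈ Finset.range k, p.gap N j : ℝ) : ℂ) * q := by
  induction k with
  | zero => simp [raiseChain, chainPoly]
  | succ k ih =>
    rw [raiseChain, chainPoly]
    beta_reduce
    rw [h.raise_lower hnu, raiseChain_C_mul, ih, ← mul_assoc,
      ← Polynomial.C_mul, ← Complex.ofReal_mul, Finset.prod_range_succ, mul_comm (p.gap N k)]

theorem chainPoly_C_mul (p : PTParams) (N k : ℕ) (c : ℂ) (q : ℂ[X]) :
    p.chainPoly N (C c * q) k = C c * p.chainPoly N q k := by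
  induction k with
  | zero => rfl
  | succ k ih => simp only [chainPoly, ih, lowerPoly_C_mul]

/-! ### The Jacobi eigenfunctions as starting points of the chains -/

/-- The polynomial in `cot θ` of the eigenfunction before normalization. -/
noncomputable def rawPoly (p : PTParams) (N : ℕ) : ℂ[X] :=
  (jacobiPoly N (p.jacobiParam N) (star (p.jacobiParam N))).comp
    (C (Complex.I / 2) * X - C (1 / 2))

theorem rawEigenfunction_eq_wave (p : PTParams) (N : ℕ) :
    p.rawEigenfunction N = p.wave N (p.rawPoly N) := by
  funext x
  simp only [rawEigenfunction, wave, rawPoly, jacobiP_eq_eval, eval_comp, level]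
  congr 2
  · rw [show p.nu + (N : ℝ) + 1 = N + p.nu + 1 by ring]
  · simp; ring

theorem jacobiParam_eq (p : PTParams) (N : ℕ) :
    p.jacobiParam N = -(p.level N : ℂ) + Complex.I * (p.beta / p.level N) := by
  apply Complex.ext
  · rw [← Complex.ofReal_div]; simp [jacobiParam, level, -Complex.ofReal_div]
  · rw [← Complex.ofReal_div]; simp [jacobiParam, level, -Complex.ofReal_div]

theorem star_jacobiParam_eq (p : PTParams) (N : ℕ) :
    star (p.jacobiParam N) = -(p.level N : ℂ) - Complex.I * (p.beta / p.level N) := by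
  rw [jacobiParam_eq]
  simp [sub_eq_add_neg]

theorem rawPoly_ne_zero {p : PTParams} (hnu : 0 ≤ p.nu) (N : ℕ) : p.rawPoly N ≠ 0 := by
  have hJ : jacobiPoly N (p.jacobiParam N) (star (p.jacobiParam N)) ≠ 0 := by
    intro h0
    have h1 := coeff_jacobiPoly N (p.jacobiParam N) (star (p.jacobiParam N)) N
    rw [h0] at h1
    rw [coeff_zero, Nat.choose_self, Nat.sub_self, ascPochhammer_zero, eval_one, Nat.cast_one,
      one_mul, mul_one, eq_comm, div_eq_zero_iff, ascPochhammer_eval_eq_zero_iff] at h1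
    rcases h1 with ⟨k, hk, h2⟩ | h2
    · rw [star_jacobiParam_eq, jacobiParam_eq] at h2
      -- Since `a + b = -2(N + ν + 1)`, a zero of the leading coefficient would force `k = N + 2ν +
      -- 1` with `k < N`.
      have h3 : ((k - (N + 2 * p.nu + 1) : ℝ) : ℂ) = 0 := by
        push_cast
        rw [h2]
        simp only [level]
        push_cast
        ring
      have h4 : (k : ℝ) < N := by exact_mod_cast hk
      rw [Complex.ofReal_eq_zero] at h3
      linarith
    · exact Nat.factorial_ne_zero N (by exact_mod_cast h2)
  intro h0
  rcases comp_eq_zero_iff.mp h0 with h1 | ⟨-, h1⟩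
  · exact hJ h1
  · have h2 := congrArg (fun g => coeff g 1) h1
    simp [coeff_C] at h2

/-- The Jacobi equation under `X = (it - 1)/2`, for which `X(1 + X) = -(1 + t²)/4`. -/
theorem rawPoly_ode {p : PTParams} (N : ℕ) (t : ℂ) :
    (1 + t ^ 2) * (derivative (derivative (p.rawPoly N))).eval t +
      (2 * (p.beta / p.level N) + 2 * (1 - p.level N) * t) * (derivative (p.rawPoly N)).eval t =
      (p.level N - p.level 0) * (1 - p.level N - p.level 0) * (p.rawPoly N).eval t := by
  have hN : (N : ℂ) = p.level N - p.level 0 := by simp [level]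
  have ode := congrArg (eval (Complex.I / 2 * t - 1 / 2))
    (jacobiPoly_ode N (p.jacobiParam N) (star (p.jacobiParam N)))
  unfold rawPoly
  generalize jacobiPoly N (p.jacobiParam N) (star (p.jacobiParam N)) = J at ode ⊢
  rw [star_jacobiParam_eq, jacobiParam_eq, hN] at ode
  simp only [derivative_add, derivative_sub, derivative_mul, derivative_C, derivative_X,
    derivative_comp, eval_comp, eval_add, eval_sub, eval_mul, eval_C, eval_X, eval_one,
    derivative_one, derivative_zero, eval_zero] at ode ⊢
  generalize eval (Complex.I / 2 * t - 1 / 2) J = j0 at ode ⊢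
  generalize eval (Complex.I / 2 * t - 1 / 2) (derivative J) = j1 at ode ⊢
  generalize eval (Complex.I / 2 * t - 1 / 2) (derivative (derivative J)) = j2 at ode ⊢
  generalize (p.level N : ℂ) = s at ode ⊢
  generalize (p.level 0 : ℂ) = r at ode ⊢
  generalize (p.beta : ℂ) / s = β at ode ⊢
  linear_combination ode + j2 / 4 * Complex.I_sq

theorem raisePoly_lowerPoly_zero {p : PTParams} (hnu : 0 ≤ p.nu) (N : ℕ) (q : ℂ[X])
    (h : ∀ t : ℂ, (1 + t ^ 2) * (derivative (derivative q)).eval t +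
      (2 * (p.beta / p.level N) + 2 * (1 - p.level N) * t) * (derivative q).eval t =
      (p.level N - p.level 0) * (1 - p.level N - p.level 0) * q.eval t) :
    p.raisePoly N 0 (p.lowerPoly N 0 q) = C (p.gap N 0 : ℂ) * q := by
  have h1 := level_ne hnu N
  have h2 := level_ne hnu 0
  apply Polynomial.funext
  intro t
  specialize h t
  simp only [lowerPoly, raisePoly, diffPoly, superPoly, gap, derivative_add, derivative_sub,
    derivative_mul, derivative_C, derivative_X, derivative_X_pow, derivative_one,
    eval_add, eval_sub, eval_mul, eval_neg, eval_C, eval_X, eval_pow, eval_one, eval_zero]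
  push_cast
  generalize eval t q = j0 at h ⊢
  generalize eval t (derivative q) = j1 at h ⊢
  generalize eval t (derivative (derivative q)) = j2 at h ⊢
  generalize (p.level N : ℂ) = s at *
  generalize (p.level 0 : ℂ) = r at *
  generalize (p.beta : ℂ) = β at *
  generalize (p.scale : ℂ) = c at *
  have hg : (s ^ 2 - r ^ 2) * (1 + β ^ 2 / (r * s) ^ 2) =
      s ^ 2 - r ^ 2 + (β / r) ^ 2 - (β / s) ^ 2 := by
    field_simp
    ring
  -- Both sides equal `β`: the terms linear in `t` cancel because the `cot` coefficient of the
  -- potential does not depend on the level.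
  have hβ : s * (β / s) = r * (β / r) := by field_simp
  rw [mul_assoc (c ^ 2), hg]
  clear hg
  generalize β / s = u at *
  generalize β / r = v at *
  linear_combination -(1 + t ^ 2) * c ^ 2 * h + 2 * t * c ^ 2 * j0 * hβ

theorem natDegree_rawPoly_le (p : PTParams) (N : ℕ) : (p.rawPoly N).natDegree ≤ N := by
  have h1 : (C (Complex.I / 2) * X - C (1 / 2) : ℂ[X]).natDegree ≤ 1 := by compute_degree
  have h2 := natDegree_jacobiPoly_le N (p.jacobiParam N) (star (p.jacobiParam N))
  rw [rawPoly, natDegree_comp]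
  exact (Nat.mul_le_mul h2 h1).trans_eq (mul_one N)

theorem isBase_rawPoly {p : PTParams} (hnu : 0 ≤ p.nu) (N : ℕ) : p.IsBase N (p.rawPoly N) where
  natDegree_le := natDegree_rawPoly_le p N
  eigen := raisePoly_lowerPoly_zero hnu N _ (rawPoly_ode N)

/-! ### Waves as functions: derivative, continuity up to the boundary, smoothness -/

theorem wave_add (p : PTParams) (N : ℕ) (f g : ℂ[X]) (x : ℝ) :
    p.wave N (f + g) x = p.wave N f x + p.wave N g x := by
  simp only [wave, eval_add]; ring

theorem wave_neg (p : PTParams) (N : ℕ) (f : ℂ[X]) (x : ℝ) :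
    p.wave N (-f) x = -p.wave N f x := by
  simp only [wave, eval_neg]; ring

theorem wave_mul (p : PTParams) (N : ℕ) (f g : ℂ[X]) (x : ℝ) :
    p.wave N (f * g) x = f.eval ((Real.cot (Real.pi * x / p.L) : ℝ) : ℂ) * p.wave N g x := by
  simp only [wave, eval_mul]; ring

theorem wave_C_mul (p : PTParams) (N : ℕ) (c : ℂ) (g : ℂ[X]) (x : ℝ) :
    p.wave N (C c * g) x = c * p.wave N g x := by
  rw [wave_mul, eval_C]

theorem sin_pos_of_mem {p : PTParams} {x : ℝ} (hx : x ∈ Set.Ioo 0 p.L) :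
    0 < Real.sin (Real.pi * x / p.L) := by
  have hL : 0 < p.L := hx.1.trans hx.2
  apply Real.sin_pos_of_pos_of_lt_pi
  · have := hx.1; have := Real.pi_pos; positivity
  · rw [div_lt_iff₀ hL]
    exact mul_lt_mul_of_pos_left hx.2 Real.pi_pos

theorem hasDerivAt_cot {y : ℝ} (hy : Real.sin y ≠ 0) :
    HasDerivAt Real.cot (-(1 + Real.cot y ^ 2)) y := by
  have h := (Real.hasDerivAt_cos y).div (Real.hasDerivAt_sin y) hy
  have e : Real.cot = Real.cos / Real.sin := by
    funext z; simp [Real.cot_eq_cos_div_sin]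
  rw [e]
  refine h.congr_deriv ?_
  simp only [Pi.div_apply]
  field_simp
  ring

theorem hasDerivAt_wave {p : PTParams} (hhbar : 0 < p.hbar) (hnu : 0 ≤ p.nu) (N : ℕ) (q : ℂ[X])
    {x : ℝ} (hx : x ∈ Set.Ioo 0 p.L) :
    HasDerivAt (p.wave N q) (p.wave N (p.diffPoly N q) x / p.hbar) x := by
  have hs := (sin_pos_of_mem hx).ne'
  have hL : p.L ≠ 0 := (hx.1.trans hx.2).ne'
  have hθ : HasDerivAt (fun x : ℝ => Real.pi * x / p.L) (Real.pi / p.L) x := by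
    simpa using ((hasDerivAt_id x).const_mul Real.pi).div_const p.L
  have hpow := hθ.sin.rpow_const (p := p.level N) (Or.inl hs)
  rw [Real.rpow_sub_one hs] at hpow
  have hexp : HasDerivAt (fun x : ℝ => -(p.beta * Real.pi * x / (p.L * p.level N)))
      (-(p.beta * Real.pi / (p.L * p.level N))) x := by
    have h := ((hasDerivAt_id x).const_mul (p.beta * Real.pi)).div_const (p.L * p.level N)
    simp only [id_eq, mul_one] at h
    exact h.neg
  have hcot := ((hasDerivAt_cot hs).comp x hθ).ofReal_comp
  have hq := (q.hasDerivAt _).comp x hcot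
  have h := (hpow.mul hexp.exp).ofReal_comp.mul hq
  refine h.congr_deriv ?_
  have hL' : (p.L : ℂ) ≠ 0 := Complex.ofReal_ne_zero.mpr hL
  have hl' := level_ne hnu N
  have hh' : (p.hbar : ℂ) ≠ 0 := Complex.ofReal_ne_zero.mpr hhbar.ne'
  have hs' : (Complex.sin ((Real.pi * x / p.L : ℝ) : ℂ)) ≠ 0 := by
    rw [← Complex.ofReal_sin]; exact Complex.ofReal_ne_zero.mpr hs
  have hc : (Complex.cos ((Real.pi * x / p.L : ℝ) : ℂ)) =
      Complex.cot ((Real.pi * x / p.L : ℝ) : ℂ) * Complex.sin ((Real.pi * x / p.L : ℝ) : ℂ) := by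
    rw [Complex.cot_eq_cos_div_sin]; field_simp
  simp only [wave, diffPoly, scale, eval_mul, eval_sub, eval_add, eval_C, eval_X, eval_pow,
    eval_one, Function.comp_apply, Pi.mul_apply]
  push_cast at hs' hc ⊢
  rw [hc]
  field_simp
  ring

/-- Each power of `cot` is absorbed into `sin^s`. The degree bound keeps all exponents `s - i`
positive, so the right side is continuous even where `cot` blows up. -/
theorem wave_eq_sum {p : PTParams} {N : ℕ} {q : ℂ[X]} (hq : (q.natDegree : ℝ) < p.level N)
    {x : ℝ} (hx : x ∈ Set.Icc 0 p.L) :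
    p.wave N q x = (Real.exp (-(p.beta * Real.pi * x / (p.L * p.level N))) : ℂ) *
      ∑ i ∈ Finset.range (q.natDegree + 1), q.coeff i *
        ((Real.sin (Real.pi * x / p.L) ^ (p.level N - i) * Real.cos (Real.pi * x / p.L) ^ i : ℝ) :
          ℂ) := by
  have hs : 0 ≤ Real.sin (Real.pi * x / p.L) := by
    rcases (hx.1.trans hx.2).eq_or_lt with hL | hL
    · simp [← hL]
    · apply Real.sin_nonneg_of_nonneg_of_le_pi
      · have := hx.1; have := Real.pi_pos; positivity
      · rw [div_le_iff₀ hL]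
        exact mul_le_mul_of_nonneg_left hx.2 Real.pi_pos.le
  simp only [wave, Complex.ofReal_mul _ (Real.exp _)]
  rw [mul_comm (Complex.ofReal _) (Complex.ofReal (Real.exp _)), mul_assoc, eval_eq_sum_range,
    Finset.mul_sum]
  congr 1
  refine Finset.sum_congr rfl fun i hi => ?_
  have hi' : (i : ℝ) < p.level N := lt_of_le_of_lt
    (by exact_mod_cast Finset.mem_range_succ_iff.mp hi) hq
  rw [mul_left_comm]
  congr 1
  rw [← Complex.ofReal_pow, ← Complex.ofReal_mul]
  congr 1
  rcases hs.eq_or_lt with h0 | h0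
  -- At an endpoint both sides vanish, whatever value `cot` takes there.
  · rw [← h0, Real.zero_rpow (by linarith), Real.zero_rpow (by linarith)]; simp
  · rw [Real.rpow_sub_natCast h0.ne', Real.cot_eq_cos_div_sin, div_pow]
    ring

theorem continuousOn_wave {p : PTParams} {N : ℕ} {q : ℂ[X]} (hq : (q.natDegree : ℝ) < p.level N) :
    ContinuousOn (p.wave N q) (Set.Icc 0 p.L) := by
  refine ContinuousOn.congr (Continuous.continuousOn ?_) fun x hx => wave_eq_sum hq hx
  refine Continuous.mul (by fun_prop) (continuous_finsetSum _ fun i hi => ?_)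
  have hi' : (i : ℝ) < p.level N := lt_of_le_of_lt
    (by exact_mod_cast Finset.mem_range_succ_iff.mp hi) hq
  refine continuous_const.mul (Complex.continuous_ofReal.comp (Continuous.mul ?_ (by fun_prop)))
  exact Continuous.rpow_const (by fun_prop) fun _ => Or.inr (by linarith)

theorem wave_left {p : PTParams} (hnu : 0 ≤ p.nu) (N : ℕ) (q : ℂ[X]) : p.wave N q 0 = 0 := by
  simp [wave, Real.zero_rpow (level_pos hnu N).ne']

theorem wave_right {p : PTParams} (hL : 0 < p.L) (hnu : 0 ≤ p.nu) (N : ℕ) (q : ℂ[X]) :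
    p.wave N q p.L = 0 := by
  simp [wave, mul_div_cancel_right₀ _ hL.ne', Real.zero_rpow (level_pos hnu N).ne']

theorem contDiffOn_wave (p : PTParams) (N : ℕ) (q : ℂ[X]) :
    ContDiffOn ℝ ∞ (p.wave N q) (Set.Ioo 0 p.L) := by
  have hθ : ContDiff ℝ ∞ (fun x : ℝ => Real.pi * x / p.L) := by fun_prop
  have hs : ∀ x ∈ Set.Ioo 0 p.L, Real.sin (Real.pi * x / p.L) ≠ 0 :=
    fun x hx => (sin_pos_of_mem hx).ne'
  have hpow : ContDiffOn ℝ ∞ (fun x : ℝ => Real.sin (Real.pi * x / p.L) ^ p.level N)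
      (Set.Ioo 0 p.L) := hθ.sin.contDiffOn.rpow_const_of_ne hs
  have hcot : ContDiffOn ℝ ∞ (fun x : ℝ => Real.cot (Real.pi * x / p.L)) (Set.Ioo 0 p.L) :=
    (hθ.cos.contDiffOn.div hθ.sin.contDiffOn hs).congr fun x _ => Real.cot_eq_cos_div_sin _
  have hexp : ContDiff ℝ ∞ (fun x : ℝ => Real.exp (-(p.beta * Real.pi * x / (p.L * p.level N)))) := by
    fun_prop
  have hof : ContDiff ℝ ∞ (fun x : ℝ => (x : ℂ)) := Complex.ofRealCLM.contDiff
  refine ContDiffOn.mul (hof.comp_contDiffOn (hpow.mul hexp.contDiffOn)) ?_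
  have hpoly : ContDiff ℝ ∞ (fun z : ℂ => q.eval z) := by
    simpa using (contDiff_aeval (𝕜 := ℂ) q ∞).restrict_scalars ℝ
  exact hpoly.comp_contDiffOn (hof.comp_contDiffOn hcot)

theorem inL2_of_eqOn {p : PTParams} {N : ℕ} {q : ℂ[X]} (hq : (q.natDegree : ℝ) < p.level N)
    {f : ℝ → ℂ} (hf : Set.EqOn f (p.wave N q) (Set.Ioo 0 p.L)) : p.InL2 f := by
  have hc := continuousOn_wave hq
  obtain ⟨K, hK⟩ := isCompact_Icc.exists_bound_of_continuousOn hc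
  have h : MemLp (p.wave N q) 2 (volume.restrict (Set.Icc 0 p.L)) :=
    MemLp.of_bound (hc.aestronglyMeasurable measurableSet_Icc) K
      ((ae_restrict_iff' measurableSet_Icc).mpr (Filter.Eventually.of_forall hK))
  refine h.ae_eq ?_
  rw [← Measure.restrict_congr_set Ioo_ae_eq_Icc]
  exact (ae_restrict_iff' measurableSet_Ioo).mpr (Filter.Eventually.of_forall fun x hx => (hf hx).symm)

/-! ### Adjointness and norms in `L²([0, L])` -/

theorem star_eval_superPoly (p : PTParams) (k : ℕ) (y : ℝ) :
    star ((p.superPoly k).eval (y : ℂ)) = (p.superPoly k).eval (y : ℂ) := by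
  simp [superPoly]

/-- The squared norm of `wave p N q` in `L²([0, L])`. -/
noncomputable def waveNormSq (p : PTParams) (N : ℕ) (q : ℂ[X]) : ℝ :=
  ∫ x in (0 : ℝ)..p.L, ‖p.wave N q x‖ ^ 2

theorem integral_star_mul_wave (p : PTParams) (N : ℕ) (q : ℂ[X]) :
    ∫ x in (0 : ℝ)..p.L, star (p.wave N q x) * p.wave N q x = (p.waveNormSq N q : ℂ) := by
  rw [waveNormSq, ← intervalIntegral.integral_ofReal]
  refine intervalIntegral.integral_congr fun x _ => ?_
  simpa using Complex.conj_mul' (p.wave N q x)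

theorem waveNormSq_C_mul (p : PTParams) (N : ℕ) (c : ℂ) (q : ℂ[X]) :
    p.waveNormSq N (C c * q) = ‖c‖ ^ 2 * p.waveNormSq N q := by
  simp only [waveNormSq, wave_C_mul, norm_mul, mul_pow, intervalIntegral.integral_const_mul]

/-- Integration by parts: the difference of the integrands is the derivative of `ħ` times `star
(wave q) * wave r`, which vanishes at both endpoints. The terms in `W_k` cancel because `W_k` is
real. The last two degree bounds give integrability. -/
theorem integral_lower_raise {p : PTParams} (hhbar : 0 < p.hbar) (hL : 0 < p.L) (hnu : 0 ≤ p.nu)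
    {N k : ℕ} {q r : ℂ[X]} (hq : (q.natDegree : ℝ) < p.level N)
    (hr : (r.natDegree : ℝ) < p.level N)
    (hq' : ((p.lowerPoly N k q).natDegree : ℝ) < p.level N)
    (hr' : ((p.raisePoly N k r).natDegree : ℝ) < p.level N) :
    ∫ x in (0 : ℝ)..p.L, star (p.wave N (p.lowerPoly N k q) x) * p.wave N r x =
      ∫ x in (0 : ℝ)..p.L, star (p.wave N q x) * p.wave N (p.raisePoly N k r) x := by
  have cq := continuousOn_wave hq
  have cr := continuousOn_wave hr
  have cq' := continuousOn_wave hq'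
  have cr' := continuousOn_wave hr'
  have c1 : ContinuousOn (fun x => star (p.wave N (p.lowerPoly N k q) x) * p.wave N r x)
      (Set.Icc 0 p.L) := cq'.star.mul cr
  have c2 : ContinuousOn (fun x => star (p.wave N q x) * p.wave N (p.raisePoly N k r) x)
      (Set.Icc 0 p.L) := cq.star.mul cr'
  have i1 := c1.intervalIntegrable_of_Icc (μ := volume) hL.le
  have i2 := c2.intervalIntegrable_of_Icc (μ := volume) hL.le
  have hh : (p.hbar : ℂ) ≠ 0 := Complex.ofReal_ne_zero.mpr hhbar.ne'
  have hd : ∀ x ∈ Set.Ioo 0 p.L, HasDerivAt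
      (fun x => (p.hbar : ℂ) * (star (p.wave N q x) * p.wave N r x))
      (star (p.wave N (p.lowerPoly N k q) x) * p.wave N r x -
        star (p.wave N q x) * p.wave N (p.raisePoly N k r) x) x := by
    intro x hx
    have h := (((hasDerivAt_wave hhbar hnu N q hx).star).mul
      (hasDerivAt_wave hhbar hnu N r hx)).const_mul (p.hbar : ℂ)
    refine h.congr_deriv ?_
    have hst : star (p.hbar : ℂ) = p.hbar := Complex.conj_ofReal _
    simp only [lowerPoly, raisePoly, wave_add, wave_neg, wave_mul p N (p.superPoly k), star_add,
      star_mul', star_eval_superPoly, star_div₀, hst]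
    field_simp
    ring
  have c0 : ContinuousOn (fun x => (p.hbar : ℂ) * (star (p.wave N q x) * p.wave N r x))
      (Set.Icc 0 p.L) := continuousOn_const.mul (cq.star.mul cr)
  have h := intervalIntegral.integral_eq_sub_of_hasDerivAt_of_le hL.le c0 hd (i1.sub i2)
  rw [intervalIntegral.integral_sub i1 i2] at h
  simp only [wave_left hnu, wave_right hL hnu, mul_zero, sub_zero] at h
  exact sub_eq_zero.mp h

theorem IsBase.natDegree_chain_lt {p : PTParams} {N : ℕ} {q : ℂ[X]} (h : p.IsBase N q)
    (hhbar : 0 < p.hbar) (hL : 0 < p.L) (hnu : 0 ≤ p.nu) (k : ℕ) :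
    ((p.chainPoly N q k).natDegree : ℝ) < p.level N := by
  have h1 : (p.chainPoly N q k).natDegree ≤ N :=
    (h.natDegree_chain_le_sub hhbar hL hnu k).trans (Nat.sub_le _ _)
  have h2 : ((p.chainPoly N q k).natDegree : ℝ) ≤ N := by exact_mod_cast h1
  unfold level
  linarith

theorem natDegree_C_mul_lt {c : ℂ} {q : ℂ[X]} {s : ℝ} (h : (q.natDegree : ℝ) < s) :
    ((C c * q).natDegree : ℝ) < s :=
  lt_of_le_of_lt (by exact_mod_cast natDegree_C_mul_le c q) h

theorem IsBase.waveNormSq_chain {p : PTParams} {N : ℕ} {q : ℂ[X]} (h : p.IsBase N q)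
    (hhbar : 0 < p.hbar) (hL : 0 < p.L) (hnu : 0 ≤ p.nu) (k : ℕ) :
    p.waveNormSq N (p.chainPoly N q k) =
      (∏ j ∈ Finset.range k, p.gap N j) * p.waveNormSq N q := by
  induction k with
  | zero => simp [chainPoly]
  | succ k ih =>
    have hk := h.natDegree_chain_lt hhbar hL hnu k
    have hk1 := h.natDegree_chain_lt hhbar hL hnu (k + 1)
    have hr := h.raise_lower hnu k
    have h1 := integral_lower_raise hhbar hL hnu (k := k) hk hk1 hk1
      (by rw [chainPoly, hr]; exact natDegree_C_mul_lt hk)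
    rw [chainPoly, hr] at h1
    simp only [wave_C_mul, mul_left_comm _ (p.gap N k : ℂ)] at h1
    rw [intervalIntegral.integral_const_mul, integral_star_mul_wave, integral_star_mul_wave] at h1
    rw [Finset.prod_range_succ, mul_right_comm, ← ih, mul_comm, chainPoly]
    exact_mod_cast h1

theorem wave_C_ne_zero {p : PTParams} {N : ℕ} {c : ℂ} (hc : c ≠ 0) {x : ℝ}
    (hx : x ∈ Set.Ioo 0 p.L) : p.wave N (C c) x ≠ 0 := by
  rw [wave, eval_C]
  refine mul_ne_zero (Complex.ofReal_ne_zero.mpr ?_) hc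
  have := sin_pos_of_mem hx
  positivity

/-- A zero norm would propagate along the chain to the ground state, which has no zero in the open
interval. -/
theorem IsBase.waveNormSq_ne_zero {p : PTParams} {N : ℕ} {q : ℂ[X]} (h : p.IsBase N q)
    (hhbar : 0 < p.hbar) (hL : 0 < p.L) (hnu : 0 ≤ p.nu) (hq : q ≠ 0) :
    p.waveNormSq N q ≠ 0 := by
  obtain ⟨c, hc, hN⟩ := h.chain_self hhbar hL hnu hq
  intro h0
  have h1 := h.waveNormSq_chain hhbar hL hnu N
  rw [h0, mul_zero, hN] at h1
  have hcont : ContinuousOn (fun x => ‖p.wave N (C c) x‖ ^ 2) (Set.Icc 0 p.L) :=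
    (continuousOn_wave (by simpa using level_pos hnu N)).norm.pow 2
  refine (intervalIntegral.intervalIntegral_pos_of_pos_on
    (hcont.intervalIntegrable_of_Icc hL.le) (fun x hx => ?_) hL).ne' h1
  have := norm_pos_iff.mpr (wave_C_ne_zero (N := N) hc hx)
  positivity

/-! ### Normalized eigenfunctions and the actual operators -/

/-- The polynomial in `cot θ` of the normalized eigenfunction `φ_N`. -/
noncomputable def phiPoly (p : PTParams) (N : ℕ) : ℂ[X] := C (p.normConst N : ℂ) * p.rawPoly N

theorem phi_eq_wave (p : PTParams) (N : ℕ) : p.phi N = p.wave N (p.phiPoly N) := by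
  funext x
  rw [phi, rawEigenfunction_eq_wave, phiPoly, wave_C_mul]

theorem normConst_eq (p : PTParams) (N : ℕ) :
    p.normConst N = (Real.sqrt (p.waveNormSq N (p.rawPoly N)))⁻¹ := by
  rw [normConst, rawEigenfunction_eq_wave]; rfl

theorem waveNormSq_nonneg {p : PTParams} (hL : 0 < p.L) (N : ℕ) (q : ℂ[X]) :
    0 ≤ p.waveNormSq N q :=
  intervalIntegral.integral_nonneg hL.le fun _ _ => by positivity

theorem isBase_phiPoly {p : PTParams} (hnu : 0 ≤ p.nu) (N : ℕ) : p.IsBase N (p.phiPoly N) :=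
  (isBase_rawPoly hnu N).C_mul _

theorem waveNormSq_phiPoly {p : PTParams} (hhbar : 0 < p.hbar) (hL : 0 < p.L) (hnu : 0 ≤ p.nu)
    (N : ℕ) : p.waveNormSq N (p.phiPoly N) = 1 := by
  have h := (isBase_rawPoly hnu N).waveNormSq_ne_zero hhbar hL hnu (rawPoly_ne_zero hnu N)
  rw [phiPoly, waveNormSq_C_mul, normConst_eq, Complex.norm_real, Real.norm_eq_abs, sq_abs,
    inv_pow, Real.sq_sqrt (waveNormSq_nonneg hL _ _), inv_mul_cancel₀ h]

theorem phiPoly_ne_zero {p : PTParams} (hhbar : 0 < p.hbar) (hL : 0 < p.L) (hnu : 0 ≤ p.nu)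
    (N : ℕ) : p.phiPoly N ≠ 0 := by
  intro h
  have h1 := waveNormSq_phiPoly hhbar hL hnu N
  rw [h] at h1
  simp [waveNormSq, wave] at h1

/-- The polynomial in `cot θ` of the eigenfunction `φ_j^{(k)}`. -/
noncomputable def eigenPoly (p : PTParams) (k j : ℕ) : ℂ[X] :=
  C ((Real.sqrt (∏ i ∈ Finset.range k, p.gap (j + k) i))⁻¹ : ℂ) *
    p.chainPoly (j + k) (p.phiPoly (j + k)) k

theorem prod_gap_pos {p : PTParams} (hhbar : 0 < p.hbar) (hL : 0 < p.L) (hnu : 0 ≤ p.nu)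
    (k j : ℕ) : 0 < ∏ i ∈ Finset.range k, p.gap (j + k) i :=
  Finset.prod_pos fun i hi => gap_pos hhbar hL hnu (by have := Finset.mem_range.mp hi; omega)

theorem waveNormSq_eigenPoly {p : PTParams} (hhbar : 0 < p.hbar) (hL : 0 < p.L) (hnu : 0 ≤ p.nu)
    (k j : ℕ) : p.waveNormSq (j + k) (p.eigenPoly k j) = 1 := by
  have h := prod_gap_pos hhbar hL hnu k j
  rw [eigenPoly, waveNormSq_C_mul, (isBase_phiPoly hnu _).waveNormSq_chain hhbar hL hnu,
    waveNormSq_phiPoly hhbar hL hnu, mul_one, ← Complex.ofReal_inv, Complex.norm_real,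
    Real.norm_eq_abs, sq_abs, inv_pow, Real.sq_sqrt h.le, inv_mul_cancel₀ h.ne']

theorem eigenPoly_ground {p : PTParams} (hhbar : 0 < p.hbar) (hL : 0 < p.L) (hnu : 0 ≤ p.nu)
    (k : ℕ) : ∃ c : ℂ, c ≠ 0 ∧ p.eigenPoly k 0 = C c := by
  obtain ⟨c, hc, h⟩ := (isBase_phiPoly hnu k).chain_self hhbar hL hnu
    (phiPoly_ne_zero hhbar hL hnu k)
  have h1 := prod_gap_pos hhbar hL hnu k 0
  refine ⟨_, mul_ne_zero (inv_ne_zero (Complex.ofReal_ne_zero.mpr (Real.sqrt_pos.mpr h1).ne')) hc, ?_⟩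
  rw [C_mul, eigenPoly]
  simp only [zero_add] at *
  rw [h]

theorem hierState_eqOn {p : PTParams} (hmass : 0 < p.mass) (hL : 0 < p.L) (hnu : 0 ≤ p.nu)
    (k j : ℕ) {T : (ℝ → ℂ) → ℝ → ℂ}
    (hT : Set.EqOn (T (p.phi (j + k)))
      (p.wave (j + k) (p.chainPoly (j + k) (p.phiPoly (j + k)) k)) (Set.Ioo 0 p.L)) :
    Set.EqOn (p.hierState T k j) (p.wave (j + k) (p.eigenPoly k j)) (Set.Ioo 0 p.L) := by
  intro x hx
  have h : (2 * p.mass) ^ k * ∏ i ∈ Finset.range k, (p.energy (j + k) - p.energy i) =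
      ∏ i ∈ Finset.range k, p.gap (j + k) i := by
    simp only [← gap_eq_energy hmass hL hnu]
    rw [Finset.prod_mul_distrib, Finset.prod_const, Finset.card_range]
  rw [hierState, h, hT hx, eigenPoly, wave_C_mul, div_eq_inv_mul]

/-- The logarithmic derivative is insensitive to the constant `c`, so the normalization plays no
role. Equality on the open interval suffices, as a derivative is local. -/
theorem superpotentialOf_eq {p : PTParams} (hhbar : 0 < p.hbar) (hnu : 0 ≤ p.nu) {k : ℕ} {c : ℂ}
    (hc : c ≠ 0) {g : ℝ → ℂ} (hg : Set.EqOn g (p.wave k (C c)) (Set.Ioo 0 p.L)) {x : ℝ}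
    (hx : x ∈ Set.Ioo 0 p.L) :
    p.superpotentialOf g x =
      (p.superPoly k).eval ((Real.cot (Real.pi * x / p.L) : ℝ) : ℂ) := by
  have hh : (p.hbar : ℂ) ≠ 0 := Complex.ofReal_ne_zero.mpr hhbar.ne'
  have hd : deriv g x = p.wave k (p.diffPoly k (C c)) x / p.hbar := by
    rw [(hg.eventuallyEq_of_mem (isOpen_Ioo.mem_nhds hx)).deriv_eq]
    exact (hasDerivAt_wave hhbar hnu k _ hx).deriv
  have e : p.diffPoly k (C c) = -p.superPoly k * C c := by
    simp only [diffPoly, superPoly, derivative_C]; ring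
  have h0 := wave_C_ne_zero (N := k) hc hx
  rw [superpotentialOf, hd, hg hx, e, wave_mul, eval_neg]
  field_simp

theorem lowerWith_eqOn {p : PTParams} (hhbar : 0 < p.hbar) (hnu : 0 ≤ p.nu) {N k : ℕ} {q : ℂ[X]}
    {W f : ℝ → ℂ} (hf : Set.EqOn f (p.wave N q) (Set.Ioo 0 p.L))
    (hW : ∀ x ∈ Set.Ioo 0 p.L,
      W x = (p.superPoly k).eval ((Real.cot (Real.pi * x / p.L) : ℝ) : ℂ)) :
    Set.EqOn (p.lowerWith W f) (p.wave N (p.lowerPoly N k q)) (Set.Ioo 0 p.L) := by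
  intro x hx
  have hh : (p.hbar : ℂ) ≠ 0 := Complex.ofReal_ne_zero.mpr hhbar.ne'
  rw [lowerWith, (hf.eventuallyEq_of_mem (isOpen_Ioo.mem_nhds hx)).deriv_eq,
    (hasDerivAt_wave hhbar hnu N q hx).deriv, hf hx, hW x hx, lowerPoly, wave_add, wave_mul]
  field_simp

theorem raiseWith_eqOn {p : PTParams} (hhbar : 0 < p.hbar) (hnu : 0 ≤ p.nu) {N k : ℕ} {q : ℂ[X]}
    {W f : ℝ → ℂ} (hf : Set.EqOn f (p.wave N q) (Set.Ioo 0 p.L))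
    (hW : ∀ x ∈ Set.Ioo 0 p.L,
      W x = (p.superPoly k).eval ((Real.cot (Real.pi * x / p.L) : ℝ) : ℂ)) :
    Set.EqOn (p.raiseWith W f) (p.wave N (p.raisePoly N k q)) (Set.Ioo 0 p.L) := by
  intro x hx
  have hh : (p.hbar : ℂ) ≠ 0 := Complex.ofReal_ne_zero.mpr hhbar.ne'
  rw [raiseWith, (hf.eventuallyEq_of_mem (isOpen_Ioo.mem_nhds hx)).deriv_eq,
    (hasDerivAt_wave hhbar hnu N q hx).deriv, hf hx, hW x hx, raisePoly, wave_add, wave_neg,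
    wave_mul]
  field_simp

/-- `A_k` is itself defined through `φ_0^{(k)}`, hence through the product of the first `k`
operators. The induction therefore quantifies over all waves: its hypothesis is used both for `f`
and for `φ_k`, which determines `W_k`. -/
theorem lowerProd_eqOn {p : PTParams} (hhbar : 0 < p.hbar) (hmass : 0 < p.mass)
    (hL : 0 < p.L) (hnu : 0 ≤ p.nu) (k : ℕ) {N : ℕ} {q : ℂ[X]} {f : ℝ → ℂ}
    (hf : Set.EqOn f (p.wave N q) (Set.Ioo 0 p.L)) :
    Set.EqOn (p.lowerProd k f) (p.wave N (p.chainPoly N q k)) (Set.Ioo 0 p.L) := by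
  induction k generalizing N q f with
  | zero => exact hf
  | succ k ih =>
    refine lowerWith_eqOn hhbar hnu (ih hf) fun x hx => ?_
    obtain ⟨c, hc, h⟩ := eigenPoly_ground hhbar hL hnu k
    refine superpotentialOf_eq hhbar hnu hc ?_ hx
    have h1 := hierState_eqOn hmass hL hnu k 0 (T := p.lowerProd k)
      (ih (by rw [phi_eq_wave]; exact fun _ _ => rfl))
    rw [h, zero_add] at h1
    exact h1

theorem eigenfunction_eqOn {p : PTParams} (hhbar : 0 < p.hbar) (hmass : 0 < p.mass)
    (hL : 0 < p.L) (hnu : 0 ≤ p.nu) (k j : ℕ) :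
    Set.EqOn (p.eigenfunction k j) (p.wave (j + k) (p.eigenPoly k j)) (Set.Ioo 0 p.L) :=
  hierState_eqOn hmass hL hnu k j (lowerProd_eqOn hhbar hmass hL hnu k
    (by rw [phi_eq_wave]; exact fun _ _ => rfl))

theorem superpotential_eq {p : PTParams} (hhbar : 0 < p.hbar) (hmass : 0 < p.mass)
    (hL : 0 < p.L) (hnu : 0 ≤ p.nu) (k : ℕ) {x : ℝ} (hx : x ∈ Set.Ioo 0 p.L) :
    p.superpotential k x =
      (p.superPoly k).eval ((Real.cot (Real.pi * x / p.L) : ℝ) : ℂ) := by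
  obtain ⟨c, hc, h⟩ := eigenPoly_ground hhbar hL hnu k
  refine superpotentialOf_eq hhbar hnu hc ?_ hx
  have h1 := eigenfunction_eqOn hhbar hmass hL hnu k 0
  rwa [h, zero_add] at h1

theorem opB_eqOn {p : PTParams} (hhbar : 0 < p.hbar) (hmass : 0 < p.mass)
    (hL : 0 < p.L) (hnu : 0 ≤ p.nu) (m : ℕ) {N : ℕ} {q : ℂ[X]} {f : ℝ → ℂ}
    (hf : Set.EqOn f (p.wave N q) (Set.Ioo 0 p.L)) :
    Set.EqOn (p.opB m f) (p.wave N (p.chainPoly N q (m + 1))) (Set.Ioo 0 p.L) := by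
  rw [← lowerProd_succ_eq_opB]
  exact lowerProd_eqOn hhbar hmass hL hnu (m + 1) hf

theorem opBdag_eqOn {p : PTParams} (hhbar : 0 < p.hbar) (hmass : 0 < p.mass)
    (hL : 0 < p.L) (hnu : 0 ≤ p.nu) (m : ℕ) {N : ℕ} {q : ℂ[X]} {f : ℝ → ℂ}
    (hf : Set.EqOn f (p.wave N q) (Set.Ioo 0 p.L)) :
    Set.EqOn (p.opBdag m f) (p.wave N (p.raiseChain N (m + 1) q)) (Set.Ioo 0 p.L) := by
  have hA (k : ℕ) {q : ℂ[X]} {f : ℝ → ℂ} (hf : Set.EqOn f (p.wave N q) (Set.Ioo 0 p.L)) :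
      Set.EqOn (p.opAdag k f) (p.wave N (p.raisePoly N k q)) (Set.Ioo 0 p.L) :=
    raiseWith_eqOn hhbar hnu hf fun x hx => superpotential_eq hhbar hmass hL hnu k hx
  induction m generalizing q f with
  | zero => exact hA 0 hf
  | succ m ih => exact ih (hA (m + 1) hf)

/-! ### The eigenvalue in terms of `𝓜`, and the mean values -/

theorem prod_gap_nonneg {p : PTParams} (hhbar : 0 < p.hbar) (hL : 0 < p.L) (hnu : 0 ≤ p.nu)
    (N k : ℕ) : 0 ≤ ∏ i ∈ Finset.range k, p.gap N i := by
  rcases le_or_gt k N with h | h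
  · obtain ⟨j, rfl⟩ := Nat.exists_eq_add_of_le' h
    exact (prod_gap_pos hhbar hL hnu k j).le
  -- Some gaps may be negative here, but the factor `i = N` is zero.
  · rw [Finset.prod_eq_zero (Finset.mem_range.mpr h) (gap_self p N)]

theorem scale_mul_calM_sq {p : PTParams} (hhbar : 0 < p.hbar) (hL : 0 < p.L) (hnu : 0 ≤ p.nu)
    (N m : ℕ) (z : ℤ) (hz : z + m + 1 = N) :
    (p.scale ^ (m + 1) * p.calM z m) ^ 2 = ∏ k ∈ Finset.range (m + 1), p.gap N k := by
  have hz' : (z : ℝ) = N - m - 1 := by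
    have : ((z + m + 1 : ℤ) : ℝ) = ((N : ℤ) : ℝ) := by rw [hz]
    push_cast at this
    linarith
  have hg (k : ℕ) : p.gap N k = p.scale ^ 2 * (((z : ℝ) + m - k + 1) *
      ((z : ℝ) + m + 2 * p.nu + k + 3) *
      (1 + p.beta ^ 2 / (((k : ℝ) + p.nu + 1) * ((z : ℝ) + m + p.nu + 2)) ^ 2)) := by
    have e : (z : ℝ) + m + p.nu + 2 = N + p.nu + 1 := by rw [hz']; ring
    rw [e, hz', gap, level, level]
    ring
  have h := prod_gap_nonneg hhbar hL hnu N (m + 1)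
  simp only [hg] at h ⊢
  rw [Finset.prod_mul_distrib, Finset.prod_const, Finset.card_range] at h ⊢
  rw [mul_pow, calM, Real.sq_sqrt, pow_right_comm]
  -- The radicand of `𝓜` is nonnegative because its product with a positive power of the scale is a
  -- product of gaps.
  exact nonneg_of_mul_nonneg_right h (by have := scale_pos hhbar hL; positivity)

theorem meanValue_eq_of_eqOn {p : PTParams} (hL : 0 < p.L) {N : ℕ} {q : ℂ[X]} {c : ℂ}
    {T : (ℝ → ℂ) → ℝ → ℂ} {f : ℝ → ℂ} (hf : Set.EqOn f (p.wave N q) (Set.Ioo 0 p.L))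
    (hT : Set.EqOn (T f) (p.wave N (C c * q)) (Set.Ioo 0 p.L)) :
    p.meanValue T f = c * p.waveNormSq N q := by
  rw [meanValue, ← integral_star_mul_wave, ← intervalIntegral.integral_const_mul,
    intervalIntegral.integral_of_le hL.le, intervalIntegral.integral_of_le hL.le,
    integral_Ioc_eq_integral_Ioo, integral_Ioc_eq_integral_Ioo]
  refine setIntegral_congr_fun measurableSet_Ioo fun x hx => ?_
  simp only [hf hx, hT hx, wave_C_mul]
  ring

end PTParams

theorem proposition5 (p : PTParams) (hhbar : 0 < p.hbar) (hmass : 0 < p.mass) (hL : 0 < p.L)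
    (hnu : 0 ≤ p.nu) (hbeta : 0 ≤ p.beta) (m n : ℕ) :
    -- the superpotentials and all derivatives that occur exist on the open interval
    (∀ k ≤ m, ∀ x ∈ Set.Ioo (0 : ℝ) p.L, p.eigenfunction k 0 x ≠ 0) ∧
    (∀ k ≤ m + 1, ∀ j : ℕ, ContDiffOn ℝ ∞ (p.eigenfunction k j) (Set.Ioo (0 : ℝ) p.L)) ∧
    -- the mean value of `B_m B_m†` in the state `φ_n^{(m+1)}`
    (p.InL2 (p.eigenfunction (m + 1) n) ∧
      p.InL2 (p.opB m (p.opBdag m (p.eigenfunction (m + 1) n))) ∧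
      p.meanValue (fun f => p.opB m (p.opBdag m f)) (p.eigenfunction (m + 1) n) =
        ((((Real.pi * p.hbar / p.L) ^ (m + 1) * p.calM (n : ℤ) m) ^ 2 : ℝ) : ℂ)) ∧
    -- the mean value of `B_m† B_m` in the state `φ_n`
    (p.InL2 (p.phi n) ∧
      p.InL2 (p.opBdag m (p.opB m (p.phi n))) ∧
      p.meanValue (fun f => p.opBdag m (p.opB m f)) (p.phi n) =
        ((((Real.pi * p.hbar / p.L) ^ (m + 1) * p.calM ((n : ℤ) - m - 1) m) ^ 2 : ℝ) : ℂ)) := by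
  have base := fun N => PTParams.isBase_phiPoly hnu N (p := p)
  have hlt : ∀ N k, ((p.chainPoly N (p.phiPoly N) k).natDegree : ℝ) < p.level N :=
    fun N k => (base N).natDegree_chain_lt hhbar hL hnu k
  refine ⟨fun k _ x hx => ?_, fun k _ j => ?_, ?_, ?_⟩
  · obtain ⟨c, hc, h⟩ := PTParams.eigenPoly_ground hhbar hL hnu k
    rw [PTParams.eigenfunction_eqOn hhbar hmass hL hnu k 0 hx, h]
    exact PTParams.wave_C_ne_zero hc hx
  · exact (p.contDiffOn_wave _ _).congr (PTParams.eigenfunction_eqOn hhbar hmass hL hnu k j)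
  · have hE := PTParams.eigenfunction_eqOn hhbar hmass hL hnu (m + 1) n
    have hT := PTParams.opB_eqOn hhbar hmass hL hnu m (PTParams.opBdag_eqOn hhbar hmass hL hnu m hE)
    have hdeg : ((p.eigenPoly (m + 1) n).natDegree : ℝ) < p.level (n + (m + 1)) :=
      PTParams.natDegree_C_mul_lt (hlt _ _)
    -- The state is a multiple of the chain element of `φ_{n+m+1}`: raising returns to `φ_{n+m+1}`
    -- times the product of gaps, and lowering again restores the state.
    have e : p.chainPoly (n + (m + 1)) (p.raiseChain (n + (m + 1)) (m + 1) (p.eigenPoly (m + 1) n))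
        (m + 1) = Polynomial.C ((∏ k ∈ Finset.range (m + 1), p.gap (n + (m + 1)) k : ℝ) : ℂ) *
          p.eigenPoly (m + 1) n := by
      rw [PTParams.eigenPoly, PTParams.raiseChain_C_mul, (base _).raiseChain_chain hnu,
        PTParams.chainPoly_C_mul, PTParams.chainPoly_C_mul]
      ring
    rw [e] at hT
    refine ⟨PTParams.inL2_of_eqOn hdeg hE,
      PTParams.inL2_of_eqOn (PTParams.natDegree_C_mul_lt hdeg) hT, ?_⟩
    rw [PTParams.meanValue_eq_of_eqOn hL hE hT, PTParams.waveNormSq_eigenPoly hhbar hL hnu,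
      ← PTParams.scale_mul_calM_sq hhbar hL hnu (n + (m + 1)) m n (by push_cast; ring),
      Complex.ofReal_one, mul_one, PTParams.scale]
  · have hE : Set.EqOn (p.phi n) (p.wave n (p.phiPoly n)) (Set.Ioo 0 p.L) := by
      rw [PTParams.phi_eq_wave]
      exact fun _ _ => rfl
    have hT := PTParams.opBdag_eqOn hhbar hmass hL hnu m (PTParams.opB_eqOn hhbar hmass hL hnu m hE)
    rw [(base n).raiseChain_chain hnu] at hT
    have hdeg : ((p.phiPoly n).natDegree : ℝ) < p.level n := hlt n 0
    refine ⟨PTParams.inL2_of_eqOn hdeg hE,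
      PTParams.inL2_of_eqOn (PTParams.natDegree_C_mul_lt hdeg) hT, ?_⟩
    rw [PTParams.meanValue_eq_of_eqOn hL hE hT, PTParams.waveNormSq_phiPoly hhbar hL hnu,
      -- The argument `n - m - 1` is an integer, negative when `n ≤ m`; both sides are then zero.
      ← PTParams.scale_mul_calM_sq hhbar hL hnu n m (n - m - 1) (by ring),
      Complex.ofReal_one, mul_one, PTParams.scale]
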